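/- **Model.** Let $\mathcal N=\{1,\dots,N\}$ be the set of ability states, $\Pi=(\pi_{nn'})$ an irreducible $N\times N$ transition probability matrix, $\varpi$ a probability vector on $\mathcal N$, and $\upsilon\in(0,1)$ the survival probability. Let $\tau_{\mathrm K},\tau_{\mathrm L}\in[0,1)$ and $\tau_{\mathrm C}\ge 0$ be tax rates, $\beta\in(0,1)$ the discount factor, $\gamma>0$ the relative risk aversion, $\delta\ge 0$ the depreciation rate, $R>\upsilon$ the gross risk-free rate and $\omega>0$ the wage. For each $n$ let $F_n:[0,\infty)^2\to[0,\infty)$ be a production function. For at most one $n$ it is identically zero; every other $F_n$ is continuous, homogeneous of degree one, strictly concave in its second argument when its first argument is positive, and satisfies $F_n(0,\ell)=0$ for all $\ell\ge0$ and $\lim_{\ell\to\infty}F_n(1,\ell)/\ell=0$. Put $$r_n=(1-\tau_{\mathrm K})\max_{\ell\ge0}\bigl(F_n(1,\ell)-\delta-\omega\ell\bigr),\qquad R_n(\theta)=\tfrac1\upsilon\bigl((1+r_n)\theta+R(1-\theta)\bigr),\qquad h=\frac{(1-\tau_{\mathrm L})\omega}{1-\upsilon/R},$$ and assume $1+r_n>0$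 for all $n$. Let $\nu_\gamma(c)=(c^{1-\gamma}-1)/(1-\gamma)$ if $\gamma\ne1$ and $\nu_1(c)=\log c$, for $c>0$. For $a\in(0,\infty)^N$ let $g_n(\theta;a)=\sum_{n'}\pi_{nn'}\nu_\gamma(a_{n'}R_{n'}(\theta))$. Let $a^*\in(0,\infty)^N$ and $\theta^*\in[0,1]^N$ be such that, for each $n$, $\theta^*_n$ maximizes $g_n(\cdot\,;a^*)$ over $[0,1]$ and $$a^*_n=\Bigl(\frac{1-\beta}{1+\tau_{\mathrm C}}\Bigr)^{1-\beta}\bigl(\beta\,\nu_\gamma^{-1}(g_n(\theta_n^*;a^*))\bigr)^{\beta}.$$ Put $G_{nn'}=\beta R_{n'}(\theta_n^*)$. Let $(S_t,J_t)_{t\ge0}$ be the Markov process of wealth and ability which, from $(S_t,J_t)=(s,n)$, moves with probability $\upsilon\pi_{nn'}$ to $(G_{nn'}s,n')$ (survival) and with probability $(1-\upsilon)\varpi_{n'}$ to $(h,n')$ (reset), for each $n'\in\mathcal N$. For complex $z$ let $\mathrm A(z)$ be the $N\times N$ matrix with $(n,n')$-entry $\upsilon\pi_{nn'}G_{nn'}^z$,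 let $\rho$ denote the spectral radius, and let $\mathcal I_-$ be the set of all real $z$ with $\rho(\mathrm A(z))<1$. **Claim.** The process has exactly one stationary distribution. Let $(S,J)$ be a random draw from it, and let $p_n=\mathrm P(J=n)$. 1. For each complex $z$ with real part in $\mathcal I_-$, the matrix $\mathrm I-\mathrm A(z)$ is invertible, the expectations below exist (the integrands are integrable), and $$\mathrm E(S^z\mid J=n)=(1-\upsilon)p_n^{-1}h^z\varpi^\top(\mathrm I-\mathrm A(z))^{-1}e^{(n)}\quad\text{for each }n\in\mathcal N\text{ with }p_n>0,$$ $$\mathrm E(S^z)=(1-\upsilon)h^z\varpi^\top(\mathrm I-\mathrm A(z))^{-1}1_N,$$ where $e^{(n)}$ is the $n$th unit vector and $1_N$ is the vector of ones. 2. If the equation $\rho(\mathrm A(z))=1$ admits a unique positive solution $z=\zeta$, then $$\lim_{s\to\infty}\frac{\log \mathrm P(S>s)}{\log s}=-\zeta .$$ -/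

import Mathlib

open MeasureTheory ProbabilityTheory Filter Topology Matrix

/-- The Box-Cox transformation `ν_γ` on `(0, ∞)`. -/
noncomputable def boxCox (γ c : ℝ) : ℝ :=
  if γ = 1 then Real.log c else (c ^ (1 - γ) - 1) / (1 - γ)

/-- The inverse `ν_γ⁻¹` of the Box-Cox transformation. -/
noncomputable def boxCoxInv (γ x : ℝ) : ℝ :=
  if γ = 1 then Real.exp x else (1 + (1 - γ) * x) ^ (1 / (1 - γ))

theorem boxCoxInv_boxCox (γ : ℝ) {c : ℝ} (hc : 0 < c) : boxCoxInv γ (boxCox γ c) = c := by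
  unfold boxCoxInv boxCox
  by_cases h : γ = 1
  · simp [h, Real.exp_log hc]
  · have h' : 1 - γ ≠ 0 := sub_ne_zero.mpr (Ne.symm h)
    simp only [h, if_false]
    rw [mul_div_cancel₀ _ h', add_sub_cancel, ← Real.rpow_mul hc.le, mul_one_div_cancel h',
      Real.rpow_one]

/-- The primitives and prices of the model with `N` ability states. -/
structure Economy (N : ℕ) where
  /-- transition probability matrix of the ability state of a surviving agent -/
  trans : Matrix (Fin N) (Fin N) ℝ
  /-- distribution `ϖ` of the ability state of a newborn agent -/
  birth : Fin N → ℝ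
  /-- survival probability `υ` -/
  surv : ℝ
  /-- production functions `F n k l` -/
  F : Fin N → ℝ → ℝ → ℝ
  /-- depreciation rate of capital -/
  δ : ℝ
  /-- capital income tax rate -/
  τK : ℝ
  /-- labor income tax rate -/
  τL : ℝ
  /-- consumption tax rate -/
  τC : ℝ
  /-- discount factor -/
  β : ℝ
  /-- relative risk aversion -/
  γ : ℝ
  /-- gross risk-free rate -/
  R : ℝ
  /-- wage -/
  ω : ℝ

/-- The conditions on the production function of an entrepreneur. -/
structure IsProductionFunction (F : ℝ → ℝ → ℝ) : Prop where
  nonneg : ∀ k l, 0 ≤ k → 0 ≤ l → 0 ≤ F k l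
  continuousOn : ContinuousOn (fun x : ℝ × ℝ => F x.1 x.2) (Set.Ici 0 ×ˢ Set.Ici 0)
  homogeneous : ∀ c k l, 0 ≤ c → 0 ≤ k → 0 ≤ l → F (c * k) (c * l) = c * F k l
  strictConcaveOn : ∀ k, 0 < k → StrictConcaveOn ℝ (Set.Ici 0) (F k)
  zero_left : ∀ l, 0 ≤ l → F 0 l = 0
  inada : Tendsto (fun l => F 1 l / l) atTop (𝓝 0)

/-- The (vanishing) production function of a pure worker. -/
def IsWorkerFunction (F : ℝ → ℝ → ℝ) : Prop :=
  ∀ k l, 0 ≤ k → 0 ≤ l → F k l = 0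

namespace Economy

variable {N : ℕ}

/-- The post-tax return on capital `r_n(ω) = (1 - τK) max_{l ≥ 0} (F_n(1, l) - δ - ω l)`. -/
noncomputable def r (E : Economy N) (n : Fin N) : ℝ :=
  (1 - E.τK) * sSup ((fun l : ℝ => E.F n 1 l - E.δ - E.ω * l) '' Set.Ici 0)

/-- The gross return on total wealth `R_n(θ)` with portfolio weight `θ` on capital. -/
noncomputable def grossReturn (E : Economy N) (n : Fin N) (θ : ℝ) : ℝ :=
  (1 / E.surv) * ((1 + E.r n) * θ + E.R * (1 - θ))

/-- Human wealth `h`. -/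
noncomputable def h (E : Economy N) : ℝ :=
  (1 - E.τL) * E.ω / (1 - E.surv / E.R)

/-- The standing assumptions of the model. -/
structure Admissible (E : Economy N) : Prop where
  trans_sum : ∀ n, ∑ n', E.trans n n' = 1
  /-- entrywise nonnegative, with a strongly connected graph of positive entries -/
  trans_irreducible : E.trans.IsIrreducible
  birth_nonneg : ∀ n, 0 ≤ E.birth n
  birth_sum : ∑ n, E.birth n = 1
  surv_pos : 0 < E.surv
  surv_lt_one : E.surv < 1
  production : ∀ n, IsWorkerFunction (E.F n) ∨ IsProductionFunction (E.F n)
  worker_unique : ∀ n m, IsWorkerFunction (E.F n) → IsWorkerFunction (E.F m) → n = m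
  δ_nonneg : 0 ≤ E.δ
  τK_nonneg : 0 ≤ E.τK
  τK_lt_one : E.τK < 1
  τL_nonneg : 0 ≤ E.τL
  τL_lt_one : E.τL < 1
  τC_nonneg : 0 ≤ E.τC
  β_pos : 0 < E.β
  β_lt_one : E.β < 1
  γ_pos : 0 < E.γ
  surv_lt_R : E.surv < E.R
  ω_pos : 0 < E.ω
  /-- the gross return on capital is positive, so that the Box-Cox transformation can be applied
  to returns on wealth for every portfolio weight in `[0, 1]` -/
  one_add_r_pos : ∀ n, 0 < 1 + E.r n

/-- The objective `g_n(θ; a)` of the portfolio choice problem. -/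
noncomputable def g (E : Economy N) (a : Fin N → ℝ) (n : Fin N) (θ : ℝ) : ℝ :=
  ∑ n', E.trans n n' * boxCox E.γ (a n' * E.grossReturn n' θ)

/-- `a` is the positive solution `a*` of the system
`a_n = ((1 - β) / (1 + τC)) ^ (1 - β) * (β κ_n(a)) ^ β`, where `κ_n(a) = ν_γ⁻¹ (g_n(θ_n; a))` and
`θ_n` maximizes `g_n(·; a)` over `[0, 1]`; the `θ_n` are then optimal portfolio weights `θ*_n`. -/
structure IsOptimal (E : Economy N) (a θ : Fin N → ℝ) : Prop where
  a_pos : ∀ n, 0 < a n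
  θ_mem : ∀ n, θ n ∈ Set.Icc (0 : ℝ) 1
  θ_max : ∀ n, IsMaxOn (E.g a n) (Set.Icc 0 1) (θ n)
  a_eq : ∀ n, a n = ((1 - E.β) / (1 + E.τC)) ^ (1 - E.β) *
    (E.β * boxCoxInv E.γ (E.g a n (θ n))) ^ E.β

/-- The gross growth rate `G n n'` of the wealth of an agent with portfolio weights `θ` who
survives and moves from ability state `n` to ability state `n'`. -/
noncomputable def G (E : Economy N) (θ : Fin N → ℝ) (n n' : Fin N) : ℝ :=
  E.β * E.grossReturn n' (θ n)

/-- The conditional law of `(S_{t+1}, J_{t+1})` given `(S_t, J_t) = x`. -/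
noncomputable def stepLaw (E : Economy N) (θ : Fin N → ℝ) (x : ℝ × Fin N) :
    Measure (ℝ × Fin N) :=
  ENNReal.ofReal E.surv •
      ∑ n', ENNReal.ofReal (E.trans x.2 n') • Measure.dirac (E.G θ x.2 n' * x.1, n')
    + ENNReal.ofReal (1 - E.surv) •
      ∑ n', ENNReal.ofReal (E.birth n') • Measure.dirac (E.h, n')

theorem measurable_stepLaw (E : Economy N) (θ : Fin N → ℝ) : Measurable (E.stepLaw θ) := by
  refine Measure.measurable_of_measurable_coe _ fun s hs => ?_
  simp only [stepLaw, Measure.coe_add, Measure.coe_smul, Measure.coe_finsetSum, Pi.add_apply,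
    Pi.smul_apply, Finset.sum_apply, smul_eq_mul]
  refine Measurable.add (Measurable.const_mul (Finset.measurable_sum _ fun n' _ => ?_) _)
    measurable_const
  refine Measurable.mul ((measurable_from_top (f := fun n => ENNReal.ofReal (E.trans n n'))).comp
    measurable_snd) ?_
  have hG : Measurable fun x : ℝ × Fin N => E.G θ x.2 n' :=
    (measurable_from_top (f := fun n => E.G θ n n')).comp measurable_snd
  exact (Measure.measurable_coe hs).comp
    (Measure.measurable_dirac.comp ((hG.mul measurable_fst).prodMk measurable_const))

/-- The transition kernel of the Markov process `(S_t, J_t)` of total wealth and ability of a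
succession of agents: with probability `υ` the agent survives, ability moves according to the
transition matrix and wealth is multiplied by `G`; with probability `1 - υ` wealth is reset to `h`
and ability is drawn from `ϖ`. -/
noncomputable def kernel (E : Economy N) (θ : Fin N → ℝ) :
    Kernel (ℝ × Fin N) (ℝ × Fin N) where
  toFun := E.stepLaw θ
  measurable' := E.measurable_stepLaw θ

/-- `μ` is a stationary joint distribution of wealth and ability. -/
structure IsStationary (E : Economy N) (θ : Fin N → ℝ) (μ : Measure (ℝ × Fin N)) : Prop where
  isProbabilityMeasure : IsProbabilityMeasure μ
  invariant : (E.kernel θ).Invariant μ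

/-- The matrix `A(z)`, with entries `υ π_{nn'} G_{nn'} ^ z`. -/
noncomputable def A (E : Economy N) (θ : Fin N → ℝ) (z : ℂ) : Matrix (Fin N) (Fin N) ℂ :=
  Matrix.of fun n n' => (E.surv : ℂ) * (E.trans n n' : ℂ) * (E.G θ n n' : ℂ) ^ z

/-- The set `𝓘₋` of real numbers at which the spectral radius of `A` is less than one. -/
def IMinus (E : Economy N) (θ : Fin N → ℝ) : Set ℝ :=
  {x | spectralRadius ℂ (E.A θ (x : ℂ)) < 1}

end Economy

/-! Stationary law: resets do not depend on the current state, so invariance reads `μ = μK + reset`,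
where `K` is the sub-Markov survival kernel of mass `υ`. Summing over age, `Σ_k reset·K^k` is a
solution of mass one. Iterating the equation shows that any stationary `μ` dominates every partial
sum, hence the whole series, and two probability measures so ordered coincide (`eq_stationaryLaw`).

Moments: the cohort of age `k` has moment `(1-υ) h^x ϖᵀ A(x)^k 1`, which is summable over `k` when
`ρ(A(x)) < 1`. Since `|s^z| = s^(Re z)`, complex moments exist too. Testing invariance on `s^z
1{J=n}` gives the linear system `mᵀ(I - A(z)) = (1-υ) h^z ϖᵀ` (`abilityMoment_eq`), which is then
inverted.

Tail: spectral radii are handled through geometric bounds on entries of powers, and Hölder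
interpolation against `A(0) = υΠ` gives `ρ(A(x)) < 1` for `0 < x < ζ`. Markov's inequality then
yields the upper bound. For the lower bound at `y > ζ`, suppose that all return paths to `i` had
growth tails below `e^(-yu)`. Then the diagonal entries of `A(x)^k` would be bounded for `ζ < x <
y`, by irreducibility so would all entries, and interpolation would give `ρ(A(ζ)) < 1`, a
contradiction. So some return event beats `e^(-yu)`, and repeating it gives a power lower bound at
every level (`exists_le_growthTail`). -/

namespace Matrix

variable {ι : Type*} [Fintype ι] [DecidableEq ι]

/-! ### Spectral radius and geometric bounds on powers. -/

section SpectralRadius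

-- The spectral radius depends only on the algebra structure, so any Banach algebra norm may serve
-- in Gelfand's formula.
attribute [local instance] Matrix.linftyOpNormedRing Matrix.linftyOpNormedAlgebra

theorem norm_entry_le_linfty_opNorm (M : Matrix ι ι ℂ) (i j : ι) : ‖M i j‖ ≤ ‖M‖ := by
  rw [Matrix.linfty_opNorm_def]
  have h1 : ‖M i j‖₊ ≤ ∑ j, ‖M i j‖₊ :=
    Finset.single_le_sum (f := fun j => ‖M i j‖₊) (fun _ _ => zero_le) (Finset.mem_univ j)
  have h2 := Finset.le_sup (f := fun i => ∑ j, ‖M i j‖₊) (Finset.mem_univ i)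
  exact_mod_cast h1.trans h2

theorem linfty_opNorm_le_of_entry_le (M : Matrix ι ι ℂ) {c : ℝ} (hc : 0 ≤ c)
    (h : ∀ i j, ‖M i j‖ ≤ c) : ‖M‖ ≤ Fintype.card ι * c := by
  lift c to NNReal using hc
  rw [Matrix.linfty_opNorm_def]
  have : (Finset.univ.sup fun i => ∑ j, ‖M i j‖₊) ≤ Fintype.card ι * c := by
    refine Finset.sup_le fun i _ => ?_
    calc ∑ j, ‖M i j‖₊ ≤ ∑ _j : ι, c := Finset.sum_le_sum fun j _ => by exact_mod_cast h i j
      _ = Fintype.card ι * c := by simp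
  exact_mod_cast this

/-- The entries of the powers of a matrix are bounded by a geometric sequence whose ratio exceeds
the spectral radius. -/
theorem exists_norm_pow_entry_le (M : Matrix ι ι ℂ) {r : ℝ}
    (hr : spectralRadius ℂ M < ENNReal.ofReal r) :
    ∃ C : ℝ, 0 < C ∧ ∀ k i j, ‖(M ^ k) i j‖ ≤ C * r ^ k := by
  have hr0 : 0 < r := ENNReal.ofReal_pos.mp (pos_of_gt hr)
  have hev := (spectrum.pow_nnnorm_pow_one_div_tendsto_nhds_spectralRadius M).eventually_lt_const hr
  have hO : (fun k : ℕ => M ^ k) =O[atTop] fun k : ℕ => r ^ k := by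
    refine Asymptotics.IsBigO.of_bound 1 ?_
    filter_upwards [hev, eventually_gt_atTop 0] with k hk hk0
    have hk0' : (k : ℝ) ≠ 0 := by positivity
    have h1 : ((‖M ^ k‖₊ : ENNReal) ^ (1 / k : ℝ)) ^ (k : ℝ) ≤ ENNReal.ofReal r ^ (k : ℝ) :=
      ENNReal.rpow_le_rpow hk.le (by positivity)
    rw [← ENNReal.rpow_mul, one_div_mul_cancel hk0', ENNReal.rpow_one, ENNReal.rpow_natCast,
      ← ENNReal.ofReal_pow hr0.le, ← enorm_eq_nnnorm, ← ofReal_norm,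
      ENNReal.ofReal_le_ofReal_iff (by positivity)] at h1
    rw [one_mul, Real.norm_of_nonneg (by positivity)]
    exact h1
  -- Since `r ^ k` never vanishes, enlarging the constant absorbs the finitely many initial `k`.
  obtain ⟨C, hC, h⟩ := Asymptotics.bound_of_isBigO_nat_atTop hO
  refine ⟨C, hC, fun k i j => (norm_entry_le_linfty_opNorm _ i j).trans ?_⟩
  have := h (x := k) (by positivity)
  rwa [Real.norm_of_nonneg (by positivity : 0 ≤ r ^ k)] at this

/-- If `z` is in the spectrum of `M`, then `z ^ k` is in that of `M ^ k`, so `|z|^k` is at most a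
constant times `r^k`; this fails for large `k` when `|z| > r`. -/
theorem spectralRadius_le_of_norm_pow_entry_le (M : Matrix ι ι ℂ) {C r : ℝ} (hC : 0 ≤ C)
    (hr : 0 < r) (h : ∀ k i j, ‖(M ^ k) i j‖ ≤ C * r ^ k) :
    spectralRadius ℂ M ≤ ENNReal.ofReal r := by
  refine iSup₂_le fun z hz => ?_
  rw [← enorm_eq_nnnorm, ← ofReal_norm]
  refine ENNReal.ofReal_le_ofReal ?_
  by_contra! hlt
  have hz0 : 0 < ‖z‖ := hr.trans hlt
  set D : ℝ := Fintype.card ι * C * ‖(1 : Matrix ι ι ℂ)‖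
  have hbound : ∀ k : ℕ, 1 ≤ D * (r / ‖z‖) ^ k := fun k => by
    have h1 := spectrum.norm_le_norm_mul_of_mem (spectrum.pow_mem_pow M k hz)
    have h2 := linfty_opNorm_le_of_entry_le (M ^ k) (by positivity) (h k)
    rw [norm_pow] at h1
    rw [div_pow, ← mul_div_assoc, le_div_iff₀ (by positivity), one_mul]
    calc ‖z‖ ^ k ≤ ‖M ^ k‖ * ‖(1 : Matrix ι ι ℂ)‖ := h1
      _ ≤ (Fintype.card ι * (C * r ^ k)) * ‖(1 : Matrix ι ι ℂ)‖ := by gcongr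
      _ = D * r ^ k := by ring
  have hlim : Tendsto (fun k : ℕ => D * (r / ‖z‖) ^ k) atTop (𝓝 (D * 0)) :=
    (tendsto_pow_atTop_nhds_zero_of_lt_one (by positivity)
      ((div_lt_one hz0).mpr hlt)).const_mul D
  have := ge_of_tendsto' hlim hbound
  norm_num at this

theorem isUnit_one_sub_of_spectralRadius_lt_one (M : Matrix ι ι ℂ)
    (h : spectralRadius ℂ M < 1) : IsUnit (1 - M) := by
  have := spectrum.mem_resolventSet_of_spectralRadius_lt (k := (1 : ℂ)) (a := M) (by simpa using h)
  simpa [spectrum.mem_resolventSet_iff] using this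

end SpectralRadius

/-! ### Powers of entrywise nonnegative matrices. -/

theorem pow_entry_nonneg {M : Matrix ι ι ℝ} (hM : ∀ i j, 0 ≤ M i j) (k : ℕ) :
    ∀ i j, 0 ≤ (M ^ k) i j := by
  induction k with
  | zero => intro i j; rw [pow_zero, one_apply]; split_ifs <;> norm_num
  | succ k ih =>
    intro i j
    rw [pow_succ, mul_apply]
    exact Finset.sum_nonneg fun m _ => mul_nonneg (ih i m) (hM m j)

theorem pow_entry_mul_pow_entry_le {M : Matrix ι ι ℝ} (hM : ∀ i j, 0 ≤ M i j) (k l : ℕ)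
    (i m j : ι) : (M ^ k) i m * (M ^ l) m j ≤ (M ^ (k + l)) i j := by
  rw [pow_add, mul_apply]
  exact Finset.single_le_sum (f := fun m => (M ^ k) i m * (M ^ l) m j)
    (fun m _ => mul_nonneg (pow_entry_nonneg hM k i m) (pow_entry_nonneg hM l m j))
    (Finset.mem_univ m)

/-- Triangle inequality along paths; it transfers bounds from the real matrix at `z.re` to `A(z)`.
-/
theorem norm_pow_entry_le {M : Matrix ι ι ℂ} {B : Matrix ι ι ℝ} (h : ∀ i j, ‖M i j‖ ≤ B i j)
    (k : ℕ) : ∀ i j, ‖(M ^ k) i j‖ ≤ (B ^ k) i j := by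
  have hB : ∀ i j, 0 ≤ B i j := fun i j => (norm_nonneg _).trans (h i j)
  induction k with
  | zero => intro i j; rw [pow_zero, pow_zero, one_apply, one_apply]; split_ifs <;> simp
  | succ k ih =>
    intro i j
    rw [pow_succ, pow_succ, mul_apply, mul_apply]
    refine (norm_sum_le _ _).trans (Finset.sum_le_sum fun m _ => ?_)
    rw [norm_mul]
    exact mul_le_mul (ih i m) (h m j) (norm_nonneg _) (pow_entry_nonneg hB k i m)

/-- Entries of powers inherit an entrywise geometric interpolation bound, by Hölder's
inequality. -/
theorem pow_entry_le_rpow_mul_rpow {A B C : Matrix ι ι ℝ} (hA : ∀ i j, 0 ≤ A i j)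
    (hB : ∀ i j, 0 ≤ B i j) (hC : ∀ i j, 0 ≤ C i j) {t : ℝ} (ht0 : 0 < t) (ht1 : t < 1)
    (h : ∀ i j, C i j ≤ A i j ^ (1 - t) * B i j ^ t) (k : ℕ) :
    ∀ i j, (C ^ k) i j ≤ (A ^ k) i j ^ (1 - t) * (B ^ k) i j ^ t := by
  have ht1' : 0 < 1 - t := sub_pos.mpr ht1
  induction k with
  | zero =>
    intro i j
    simp only [pow_zero, one_apply]
    split_ifs
    · simp
    · simp [Real.zero_rpow ht0.ne']
  | succ k ih =>
    intro i j
    rw [pow_succ, pow_succ, pow_succ, mul_apply, mul_apply, mul_apply]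
    have hpq : (1 / (1 - t)).HolderConjugate (1 / t) := by
      rw [Real.holderConjugate_iff]
      refine ⟨?_, by simp⟩
      rw [lt_div_iff₀ ht1']; linarith
    have hAm : ∀ m, 0 ≤ (A ^ k) i m * A m j := fun m =>
      mul_nonneg (pow_entry_nonneg hA k i m) (hA m j)
    have hBm : ∀ m, 0 ≤ (B ^ k) i m * B m j := fun m =>
      mul_nonneg (pow_entry_nonneg hB k i m) (hB m j)
    have hH := Real.inner_le_Lp_mul_Lq_of_nonneg Finset.univ hpq
      (f := fun m => ((A ^ k) i m * A m j) ^ (1 - t)) (g := fun m => ((B ^ k) i m * B m j) ^ t)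
      (fun m _ => Real.rpow_nonneg (hAm m) _) (fun m _ => Real.rpow_nonneg (hBm m) _)
    simp only [one_div_one_div] at hH
    have e1 : ∀ m, (((A ^ k) i m * A m j) ^ (1 - t)) ^ (1 / (1 - t)) = (A ^ k) i m * A m j :=
      fun m => by rw [← Real.rpow_mul (hAm m), mul_one_div_cancel ht1'.ne', Real.rpow_one]
    have e2 : ∀ m, (((B ^ k) i m * B m j) ^ t) ^ (1 / t) = (B ^ k) i m * B m j :=
      fun m => by rw [← Real.rpow_mul (hBm m), mul_one_div_cancel ht0.ne', Real.rpow_one]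
    simp only [e1, e2] at hH
    refine le_trans (Finset.sum_le_sum fun m _ => ?_) hH
    calc (C ^ k) i m * C m j
        ≤ ((A ^ k) i m ^ (1 - t) * (B ^ k) i m ^ t) * (A m j ^ (1 - t) * B m j ^ t) :=
          mul_le_mul (ih i m) (h m j) (hC m j)
            (mul_nonneg (Real.rpow_nonneg (pow_entry_nonneg hA k i m) _)
              (Real.rpow_nonneg (pow_entry_nonneg hB k i m) _))
      _ = ((A ^ k) i m * A m j) ^ (1 - t) * ((B ^ k) i m * B m j) ^ t := by
          rw [Real.mul_rpow (pow_entry_nonneg hA k i m) (hA m j),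
            Real.mul_rpow (pow_entry_nonneg hB k i m) (hB m j)]
          ring

/-- For an irreducible matrix, boundedness of one diagonal entry of the powers implies boundedness
of all entries. -/
theorem IsIrreducible.exists_pow_entry_le {M : Matrix ι ι ℝ} (hM : M.IsIrreducible) (i₀ : ι)
    {C : ℝ} (h : ∀ k, (M ^ k) i₀ i₀ ≤ C) :
    ∃ D : ℝ, 0 < D ∧ ∀ k i j, (M ^ k) i j ≤ D := by
  have hpos := (isIrreducible_iff_exists_pow_pos hM.nonneg).mp hM
  choose l _ hl using fun i => hpos i₀ i
  choose l' _ hl' using fun i => hpos i i₀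
  have hC : 0 ≤ C := (pow_entry_nonneg hM.nonneg 0 i₀ i₀).trans (h 0)
  -- Pad a path from `i` to `j` with fixed positive paths `i₀ → i` and `j → i₀` to obtain a loop at
  -- `i₀`.
  have key : ∀ k i j, (M ^ k) i j ≤ C / ((M ^ l i) i₀ i * (M ^ l' j) j i₀) := fun k i j => by
    rw [le_div_iff₀ (mul_pos (hl i) (hl' j))]
    calc (M ^ k) i j * ((M ^ l i) i₀ i * (M ^ l' j) j i₀)
        = ((M ^ l i) i₀ i * (M ^ k) i j) * (M ^ l' j) j i₀ := by ring
      _ ≤ (M ^ (l i + k)) i₀ j * (M ^ l' j) j i₀ := by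
          gcongr
          · exact (hl' j).le
          · exact pow_entry_mul_pow_entry_le hM.nonneg _ _ _ _ _
      _ ≤ (M ^ (l i + k + l' j)) i₀ i₀ := pow_entry_mul_pow_entry_le hM.nonneg _ _ _ _ _
      _ ≤ C := h _
  have hnn : ∀ i j, 0 ≤ C / ((M ^ l i) i₀ i * (M ^ l' j) j i₀) := fun i j =>
    div_nonneg hC (mul_pos (hl i) (hl' j)).le
  refine ⟨1 + ∑ i, ∑ j, C / ((M ^ l i) i₀ i * (M ^ l' j) j i₀),
    add_pos_of_pos_of_nonneg one_pos
      (Finset.sum_nonneg fun i _ => Finset.sum_nonneg fun j _ => hnn i j), fun k i j => ?_⟩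
  calc (M ^ k) i j ≤ C / ((M ^ l i) i₀ i * (M ^ l' j) j i₀) := key k i j
    _ ≤ ∑ j, C / ((M ^ l i) i₀ i * (M ^ l' j) j i₀) :=
        Finset.single_le_sum (f := fun j => C / ((M ^ l i) i₀ i * (M ^ l' j) j i₀))
          (fun j _ => hnn i j) (Finset.mem_univ j)
    _ ≤ ∑ i, ∑ j, C / ((M ^ l i) i₀ i * (M ^ l' j) j i₀) :=
        Finset.single_le_sum (f := fun i => ∑ j, C / ((M ^ l i) i₀ i * (M ^ l' j) j i₀))
          (fun i _ => Finset.sum_nonneg fun j _ => hnn i j) (Finset.mem_univ i)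
    _ ≤ _ := by linarith

end Matrix

/-! ### Logarithmic decay rates and exponential integrals. -/

/-- A function squeezed between multiples of powers with exponents arbitrarily close to `-ζ` has
logarithmic decay rate `ζ`. -/
theorem tendsto_log_div_log_of_bounds {f : ℝ → ℝ} {ζ : ℝ} (hζ : 0 < ζ)
    (hub : ∀ x, 0 < x → x < ζ → ∃ C : ℝ, 0 < C ∧ ∀ᶠ s in atTop, f s ≤ C * s ^ (-x))
    (hlb : ∀ y, ζ < y → ∃ c : ℝ, 0 < c ∧ ∀ᶠ s in atTop, c * s ^ (-y) ≤ f s) :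
    Tendsto (fun s => Real.log (f s) / Real.log s) atTop (𝓝 (-ζ)) := by
  have hlim : ∀ C w : ℝ, Tendsto (fun s => Real.log C / Real.log s - w) atTop (𝓝 (0 - w)) :=
    fun C w => (Real.tendsto_log_atTop.const_div_atTop _).sub_const w
  have hlog : ∀ C w s : ℝ, 0 < C → 1 < s →
      Real.log (C * s ^ (-w)) / Real.log s = Real.log C / Real.log s - w := fun C w s hC hs => by
    have h0 : 0 < s := one_pos.trans hs
    rw [Real.log_mul hC.ne' (Real.rpow_pos_of_pos h0 _).ne', Real.log_rpow h0, add_div,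
      mul_div_assoc, div_self (Real.log_pos hs).ne']
    ring
  rw [tendsto_order]
  constructor
  · intro b hb
    -- The midpoint of `ζ` and `-b` exceeds `ζ`, and its negative exceeds `b`.
    obtain ⟨c, hc, h⟩ := hlb ((ζ - b) / 2) (by linarith)
    filter_upwards [h, (hlim c ((ζ - b) / 2)).eventually_const_lt (u := b) (by linarith),
      eventually_gt_atTop 1] with s h1 h2 hs
    have h0 : 0 < s := one_pos.trans hs
    rw [← hlog c _ s hc hs] at h2
    refine h2.trans_le (div_le_div_of_nonneg_right ?_ (Real.log_pos hs).le)
    exact Real.log_le_log (by positivity) h1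
  · intro b hb
    obtain ⟨x, hx1, hx2⟩ := exists_between (max_lt hζ (show -b < ζ by linarith))
    obtain ⟨C, hC, h⟩ := hub x (lt_of_le_of_lt (le_max_left _ _) hx1) hx2
    -- Any lower bound will do: it only ensures `f s > 0`, so that the logarithm is monotone there.
    obtain ⟨c, hc, h'⟩ := hlb (ζ + 1) (by linarith)
    filter_upwards [h, h', (hlim C x).eventually_lt_const (u := b)
      (by linarith [lt_of_le_of_lt (le_max_right 0 (-b)) hx1]), eventually_gt_atTop 1]
      with s h1 h3 h2 hs
    have h0 : 0 < s := one_pos.trans hs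
    rw [← hlog C _ s hC hs] at h2
    refine lt_of_le_of_lt (div_le_div_of_nonneg_right ?_ (Real.log_pos hs).le) h2
    exact Real.log_le_log (lt_of_lt_of_le (by positivity) h3) h1

theorem lintegral_Iic_ofReal_mul_exp {x : ℝ} (hx : 0 < x) :
    ∫⁻ u in Set.Iic (0 : ℝ), ENNReal.ofReal (x * Real.exp (x * u)) = 1 := by
  rw [← ofReal_integral_eq_lintegral_ofReal ((integrableOn_exp_mul_Iic hx 0).const_mul x)
    (ae_of_all _ fun u => by positivity), integral_const_mul, integral_exp_mul_Iic hx]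
  simp [hx.ne']

theorem lintegral_Ioi_ofReal_mul_exp {x w : ℝ} (hx : 0 < x) (hw : 0 < w) :
    ∫⁻ u in Set.Ioi (0 : ℝ), ENNReal.ofReal (x * Real.exp (-w * u)) = ENNReal.ofReal (x / w) := by
  have hw' : -w < 0 := neg_lt_zero.mpr hw
  rw [← ofReal_integral_eq_lintegral_ofReal ((integrableOn_exp_mul_Ioi hw' 0).const_mul x)
    (ae_of_all _ fun u => by positivity), integral_const_mul, integral_exp_mul_Ioi hw']
  simp [div_eq_mul_inv]

/-! ### The matrices `A(x)` and interpolation of their powers. -/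

namespace Economy

variable {N : ℕ}

theorem Admissible.R_pos {E : Economy N} (hE : E.Admissible) : 0 < E.R :=
  hE.surv_pos.trans hE.surv_lt_R

theorem Admissible.h_pos {E : Economy N} (hE : E.Admissible) : 0 < E.h := by
  refine div_pos (mul_pos (sub_pos.mpr hE.τL_lt_one) hE.ω_pos) ?_
  rw [sub_pos, div_lt_one hE.R_pos]
  exact hE.surv_lt_R

theorem Admissible.G_pos {E : Economy N} (hE : E.Admissible) {θ : Fin N → ℝ}
    (hθ : ∀ n, θ n ∈ Set.Icc (0 : ℝ) 1) (n n' : Fin N) : 0 < E.G θ n n' := by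
  refine mul_pos hE.β_pos (mul_pos (one_div_pos.mpr hE.surv_pos) ?_)
  have h1 := hE.one_add_r_pos n'
  have h2 := hE.R_pos
  obtain ⟨h3, h4⟩ := hθ n
  rcases h3.eq_or_lt with h | h
  · rw [← h]; simpa using h2
  · exact add_pos_of_pos_of_nonneg (mul_pos h1 h) (mul_nonneg h2.le (sub_nonneg.mpr h4))

/-- The matrix `A(x)` at a real number `x`, as a real matrix. -/
noncomputable def realA (E : Economy N) (θ : Fin N → ℝ) (x : ℝ) : Matrix (Fin N) (Fin N) ℝ :=
  Matrix.of fun n n' => E.surv * E.trans n n' * E.G θ n n' ^ x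

section

variable {E : Economy N} {θ : Fin N → ℝ}

theorem Admissible.surv_mul_trans_nonneg (hE : E.Admissible) (i j : Fin N) :
    0 ≤ E.surv * E.trans i j :=
  mul_nonneg hE.surv_pos.le (hE.trans_irreducible.nonneg i j)

theorem realA_nonneg (hE : E.Admissible) (hG : ∀ i j, 0 < E.G θ i j) (x : ℝ) (i j : Fin N) :
    0 ≤ E.realA θ x i j :=
  mul_nonneg (hE.surv_mul_trans_nonneg i j) (Real.rpow_nonneg (hG i j).le _)

theorem norm_A_le (hE : E.Admissible) (hG : ∀ i j, 0 < E.G θ i j) (z : ℂ) (i j : Fin N) :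
    ‖E.A θ z i j‖ ≤ E.realA θ z.re i j := by
  simp only [A, realA, Matrix.of_apply, norm_mul, Complex.norm_real,
    Complex.norm_cpow_eq_rpow_re_of_pos (hG i j)]
  rw [Real.norm_of_nonneg hE.surv_pos.le, Real.norm_of_nonneg (hE.trans_irreducible.nonneg i j)]

theorem A_ofReal (hG : ∀ i j, 0 < E.G θ i j) (x : ℝ) :
    E.A θ (x : ℂ) = (E.realA θ x).map Complex.ofRealHom := by
  ext i j
  simp [A, realA, Complex.ofReal_cpow (hG i j).le]

theorem A_ofReal_pow_apply (hG : ∀ i j, 0 < E.G θ i j) (x : ℝ) (k : ℕ) (i j : Fin N) :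
    (E.A θ (x : ℂ) ^ k) i j = (((E.realA θ x ^ k) i j : ℝ) : ℂ) := by
  rw [A_ofReal hG]
  have := map_pow (Complex.ofRealHom.mapMatrix (m := Fin N)) (E.realA θ x) k
  exact (congrFun (congrFun this i) j).symm

theorem exists_realA_pow_le (hG : ∀ i j, 0 < E.G θ i j) {x r : ℝ}
    (h : spectralRadius ℂ (E.A θ (x : ℂ)) < ENNReal.ofReal r) :
    ∃ C : ℝ, 0 < C ∧ ∀ k i j, (E.realA θ x ^ k) i j ≤ C * r ^ k := by
  obtain ⟨C, hC, hb⟩ := Matrix.exists_norm_pow_entry_le _ h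
  refine ⟨C, hC, fun k i j => le_trans ?_ (hb k i j)⟩
  rw [A_ofReal_pow_apply hG, Complex.norm_real]
  exact le_abs_self _

theorem spectralRadius_A_le (hE : E.Admissible) (hG : ∀ i j, 0 < E.G θ i j) {z : ℂ} {C r : ℝ}
    (hC : 0 ≤ C) (hr : 0 < r) (h : ∀ k i j, (E.realA θ z.re ^ k) i j ≤ C * r ^ k) :
    spectralRadius ℂ (E.A θ z) ≤ ENNReal.ofReal r :=
  Matrix.spectralRadius_le_of_norm_pow_entry_le _ hC hr fun k i j =>
    (Matrix.norm_pow_entry_le (norm_A_le hE hG z) k i j).trans (h k i j)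

theorem exists_realA_pow_le_of_mem_IMinus (hG : ∀ i j, 0 < E.G θ i j) {x : ℝ}
    (hx : x ∈ E.IMinus θ) :
    ∃ C r : ℝ, 0 < C ∧ 0 < r ∧ r < 1 ∧ ∀ k i j, (E.realA θ x ^ k) i j ≤ C * r ^ k := by
  obtain ⟨q, hq1, hq2⟩ := ENNReal.lt_iff_exists_nnreal_btwn.mp (show spectralRadius ℂ _ < 1 from hx)
  have hq3 : (q : ENNReal) = ENNReal.ofReal q := by simp
  obtain ⟨C, hC, h⟩ := exists_realA_pow_le hG (hq3 ▸ hq1)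
  refine ⟨C, q, hC, ?_, by exact_mod_cast hq2, h⟩
  exact_mod_cast pos_of_gt hq1

theorem isUnit_one_sub_A (hE : E.Admissible) (hG : ∀ i j, 0 < E.G θ i j) {z : ℂ}
    (hz : z.re ∈ E.IMinus θ) : IsUnit (1 - E.A θ z) := by
  obtain ⟨C, r, hC, hr, hr1, h⟩ := exists_realA_pow_le_of_mem_IMinus hG hz
  refine Matrix.isUnit_one_sub_of_spectralRadius_lt_one _
    ((spectralRadius_A_le hE hG hC.le hr h).trans_lt ?_)
  simpa using hr1

/-- `A(0) = υΠ` with `Π` stochastic. This is the anchor of the interpolation: `υ < 1` turns weak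
bounds at `x` into strict ones between `0` and `x`. -/
theorem sum_realA_zero_pow (hE : E.Admissible) (k : ℕ) (i : Fin N) :
    ∑ j, (E.realA θ 0 ^ k) i j = E.surv ^ k := by
  induction k generalizing i with
  | zero => simp [Matrix.one_apply]
  | succ k ih =>
    simp only [pow_succ' (E.realA θ 0), Matrix.mul_apply]
    rw [Finset.sum_comm]
    simp only [← Finset.mul_sum, ih, ← Finset.sum_mul]
    simp only [realA, Matrix.of_apply, Real.rpow_zero, mul_one, ← Finset.mul_sum, hE.trans_sum]
    rw [pow_succ']

theorem realA_zero_pow_le (hE : E.Admissible) (hG : ∀ i j, 0 < E.G θ i j) (k : ℕ) (i j : Fin N) :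
    (E.realA θ 0 ^ k) i j ≤ E.surv ^ k := by
  rw [← sum_realA_zero_pow (θ := θ) hE k i]
  exact Finset.single_le_sum (f := fun j => (E.realA θ 0 ^ k) i j)
    (fun j _ => Matrix.pow_entry_nonneg (realA_nonneg hE hG 0) k i j) (Finset.mem_univ j)

/-- Log-convexity along rays: a geometric bound with ratio `r` on the powers at `x` yields one with
ratio `υ ^ (1 - t) r ^ t` at `t x`. -/
theorem realA_pow_le_of_interpolation (hE : E.Admissible) (hG : ∀ i j, 0 < E.G θ i j)
    {x t C r : ℝ} (ht0 : 0 < t) (ht1 : t < 1) (hC : 0 < C) (hr : 0 < r)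
    (h : ∀ k i j, (E.realA θ x ^ k) i j ≤ C * r ^ k) (k : ℕ) (i j : Fin N) :
    (E.realA θ (t * x) ^ k) i j ≤ C ^ t * (E.surv ^ (1 - t) * r ^ t) ^ k := by
  refine (Matrix.pow_entry_le_rpow_mul_rpow (realA_nonneg hE hG 0) (realA_nonneg hE hG x)
    (realA_nonneg hE hG (t * x)) ht0 ht1 (fun i j => ?_) k i j).trans ?_
  · simp only [realA, Matrix.of_apply, Real.rpow_zero, mul_one]
    have h0 := hE.surv_mul_trans_nonneg i j
    rw [Real.mul_rpow h0 (Real.rpow_nonneg (hG i j).le _), ← mul_assoc,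
      ← Real.rpow_add_of_nonneg h0 (sub_pos.mpr ht1).le ht0.le, sub_add_cancel, Real.rpow_one,
      ← Real.rpow_mul (hG i j).le, mul_comm x t]
  · have hs := hE.surv_pos
    calc (E.realA θ 0 ^ k) i j ^ (1 - t) * (E.realA θ x ^ k) i j ^ t
        ≤ (E.surv ^ k) ^ (1 - t) * (C * r ^ k) ^ t := by
          refine mul_le_mul
            (Real.rpow_le_rpow (Matrix.pow_entry_nonneg (realA_nonneg hE hG 0) k i j)
              (realA_zero_pow_le hE hG k i j) (sub_pos.mpr ht1).le)
            (Real.rpow_le_rpow (Matrix.pow_entry_nonneg (realA_nonneg hE hG x) k i j)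
              (h k i j) ht0.le)
            (Real.rpow_nonneg (Matrix.pow_entry_nonneg (realA_nonneg hE hG x) k i j) _)
            (by positivity)
      _ = C ^ t * (E.surv ^ (1 - t) * r ^ t) ^ k := by
          rw [Real.mul_rpow hC.le (by positivity), mul_pow, ← Real.rpow_natCast_mul hs.le,
            ← Real.rpow_natCast_mul hr.le, ← Real.rpow_mul_natCast hs.le,
            ← Real.rpow_mul_natCast hr.le, mul_comm (k : ℝ) (1 - t), mul_comm (k : ℝ) t]
          ring

/-- If the powers of `A(x)` are bounded, then the spectral radius is less than one strictly between
`0` and `x`. -/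
theorem mem_IMinus_of_bounded (hE : E.Admissible) (hG : ∀ i j, 0 < E.G θ i j) {x w C : ℝ}
    (hC : 0 < C) (hw : 0 < w) (hwx : w < x) (h : ∀ k i j, (E.realA θ x ^ k) i j ≤ C) :
    w ∈ E.IMinus θ := by
  have hx := hw.trans hwx
  have ht0 : 0 < w / x := div_pos hw hx
  have ht1 : w / x < 1 := (div_lt_one hx).mpr hwx
  have hb := realA_pow_le_of_interpolation hE hG ht0 ht1 hC one_pos
    (fun k i j => by simpa using h k i j)
  rw [div_mul_cancel₀ _ hx.ne'] at hb
  refine (spectralRadius_A_le (z := (w : ℂ)) hE hG (by positivity)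
    (mul_pos (Real.rpow_pos_of_pos hE.surv_pos _) (by positivity)) hb).trans_lt ?_
  rw [ENNReal.ofReal_lt_one, Real.one_rpow, mul_one]
  exact Real.rpow_lt_one hE.surv_pos.le hE.surv_lt_one (sub_pos.mpr ht1)

/-- A spectral radius of one yields geometric bounds only with ratio `r > 1`. Taking `r` close
enough to one, the factor `υ^(1-t)` from interpolation still brings the ratio `υ^(1-t) r^t` below
one. -/
theorem mem_IMinus_of_spectralRadius_eq_one (hE : E.Admissible) (hG : ∀ i j, 0 < E.G θ i j)
    {ζ x : ℝ} (hζ : spectralRadius ℂ (E.A θ (ζ : ℂ)) = 1) (hx : 0 < x) (hxζ : x < ζ) :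
    x ∈ E.IMinus θ := by
  have hζ0 := hx.trans hxζ
  have ht0 : 0 < x / ζ := div_pos hx hζ0
  have ht1 : x / ζ < 1 := (div_lt_one hζ0).mpr hxζ
  have hυ : E.surv ^ (1 - x / ζ) < 1 :=
    Real.rpow_lt_one hE.surv_pos.le hE.surv_lt_one (sub_pos.mpr ht1)
  have hcont : Tendsto (fun r : ℝ => E.surv ^ (1 - x / ζ) * r ^ (x / ζ)) (𝓝[>] 1)
      (𝓝 (E.surv ^ (1 - x / ζ) * 1 ^ (x / ζ))) :=
    (((Real.continuousAt_rpow_const 1 _ (Or.inl one_ne_zero)).tendsto.const_mul _).mono_left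
      nhdsWithin_le_nhds)
  obtain ⟨r, hr, hr1⟩ := ((hcont.eventually_lt_const (u := 1) (by simpa using hυ)).and
    self_mem_nhdsWithin).exists
  have hr1 : 1 < r := hr1
  obtain ⟨C, hC, h⟩ := exists_realA_pow_le hG (x := ζ) (r := r) (by rw [hζ]; simpa using hr1)
  have hb := realA_pow_le_of_interpolation hE hG ht0 ht1 hC (one_pos.trans hr1) h
  rw [div_mul_cancel₀ _ hζ0.ne'] at hb
  refine (spectralRadius_A_le (z := (x : ℂ)) hE hG (by positivity)
    (mul_pos (Real.rpow_pos_of_pos hE.surv_pos _) (by positivity)) hb).trans_lt ?_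
  rwa [ENNReal.ofReal_lt_one]

/-- Multiplying by `υ G^x > 0` preserves the pattern of positive entries of `Π`, which determines
that of each power. -/
theorem realA_isIrreducible (hE : E.Admissible) (hG : ∀ i j, 0 < E.G θ i j) (x : ℝ) :
    (E.realA θ x).IsIrreducible := by
  rw [Matrix.isIrreducible_iff_exists_pow_pos (realA_nonneg hE hG x)]
  intro i j
  obtain ⟨k, hk, hpos⟩ :=
    (Matrix.isIrreducible_iff_exists_pow_pos hE.trans_irreducible.nonneg).mp
      hE.trans_irreducible i j
  refine ⟨k, hk, ?_⟩
  clear hk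
  induction k generalizing j with
  | zero => simpa using hpos
  | succ k ih =>
    rw [pow_succ, Matrix.mul_apply] at hpos ⊢
    obtain ⟨m, -, hm⟩ := Finset.exists_lt_of_sum_lt (f := fun _ => (0 : ℝ)) (by simpa using hpos)
    have h1 := Matrix.pow_entry_nonneg hE.trans_irreducible.nonneg k i m
    have h2 := hE.trans_irreducible.nonneg m j
    refine Finset.sum_pos' (fun m _ => mul_nonneg
      (Matrix.pow_entry_nonneg (realA_nonneg hE hG x) k i m) (realA_nonneg hE hG x m j))
      ⟨m, Finset.mem_univ m, mul_pos (ih m (pos_of_mul_pos_left hm h2)) ?_⟩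
    exact mul_pos (mul_pos hE.surv_pos (pos_of_mul_pos_right hm h1)) (Real.rpow_pos_of_pos (hG m j) _)

/-! ### Tails of log wealth growth along paths. -/

/-- The probability that an agent in state `i` survives `k` periods, is then in state `j`, and has
log wealth increased by more than `u`. -/
noncomputable def growthTail (E : Economy N) (θ : Fin N → ℝ) :
    ℕ → Fin N → Fin N → ℝ → ℝ
  | 0, i, j, u => if i = j ∧ u < 0 then 1 else 0
  | k + 1, i, j, u =>
    ∑ m, E.surv * E.trans i m * growthTail E θ k m j (u - Real.log (E.G θ i m))

theorem growthTail_nonneg (hE : E.Admissible) (k : ℕ) (i j : Fin N) (u : ℝ) :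
    0 ≤ E.growthTail θ k i j u := by
  induction k generalizing i u with
  | zero => rw [growthTail]; split_ifs <;> norm_num
  | succ k ih =>
    exact Finset.sum_nonneg fun m _ => mul_nonneg (hE.surv_mul_trans_nonneg i m) (ih _ _)

theorem growthTail_le_one (hE : E.Admissible) (k : ℕ) (i j : Fin N) (u : ℝ) :
    E.growthTail θ k i j u ≤ 1 := by
  induction k generalizing i u with
  | zero => rw [growthTail]; split_ifs <;> norm_num
  | succ k ih =>
    calc E.growthTail θ (k + 1) i j u ≤ ∑ m, E.surv * E.trans i m * 1 :=
          Finset.sum_le_sum fun m _ =>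
            mul_le_mul_of_nonneg_left (ih _ _) (hE.surv_mul_trans_nonneg i m)
      _ = E.surv := by rw [← Finset.sum_mul, ← Finset.mul_sum, hE.trans_sum]; ring
      _ ≤ 1 := hE.surv_lt_one.le

theorem growthTail_antitone (hE : E.Admissible) (k : ℕ) (i j : Fin N) :
    Antitone (E.growthTail θ k i j) := by
  induction k generalizing i with
  | zero =>
    intro u v huv
    simp only [growthTail]
    split_ifs with h1 h2
    · exact le_rfl
    · exact absurd ⟨h1.1, huv.trans_lt h1.2⟩ h2
    · norm_num
    · exact le_rfl
  | succ k ih =>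
    intro u v huv
    exact Finset.sum_le_sum fun m _ => mul_le_mul_of_nonneg_left
      (ih m (sub_le_sub_right huv _)) (hE.surv_mul_trans_nonneg i m)

/-- Markov property: growth above `u` on a path `i → m`, followed by growth above `v` on a path `m →
j`, is growth above `u + v`. -/
theorem growthTail_mul_le (hE : E.Admissible) (k l : ℕ) (i m j : Fin N) (u v : ℝ) :
    E.growthTail θ k i m u * E.growthTail θ l m j v ≤ E.growthTail θ (k + l) i j (u + v) := by
  induction k generalizing i u with
  | zero =>
    rw [growthTail, zero_add]
    split_ifs with h
    · rw [one_mul, h.1]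
      exact growthTail_antitone hE l m j (by linarith [h.2])
    · rw [zero_mul]; exact growthTail_nonneg hE _ _ _ _
  | succ k ih =>
    rw [show k + 1 + l = (k + l) + 1 by ring, growthTail, growthTail, Finset.sum_mul]
    refine Finset.sum_le_sum fun n _ => ?_
    rw [mul_assoc]
    refine mul_le_mul_of_nonneg_left ((ih n _).trans_eq ?_) (hE.surv_mul_trans_nonneg i n)
    congr 1; ring

theorem growthTail_pow_le (hE : E.Admissible) (k : ℕ) (i : Fin N) (u : ℝ) (n : ℕ) :
    E.growthTail θ k i i u ^ (n + 1) ≤ E.growthTail θ (k * (n + 1)) i i ((n + 1) * u) := by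
  induction n with
  | zero => simp
  | succ n ih =>
    rw [pow_succ]
    refine (mul_le_mul_of_nonneg_right ih (growthTail_nonneg hE _ _ _ _)).trans
      ((growthTail_mul_le hE _ _ _ _ _ _ _).trans_eq ?_)
    congr 1; push_cast; ring

/-- The entries of `A(x) ^ k` are exponential moments of log wealth growth. -/
theorem ofReal_realA_pow (hE : E.Admissible) (hG : ∀ i j, 0 < E.G θ i j) {x : ℝ} (hx : 0 < x)
    (k : ℕ) (i j : Fin N) :
    ENNReal.ofReal ((E.realA θ x ^ k) i j) =
      ∫⁻ u : ℝ, ENNReal.ofReal (x * Real.exp (x * u) * E.growthTail θ k i j u) := by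
  induction k generalizing i with
  | zero =>
    rw [pow_zero, Matrix.one_apply]
    split_ifs with hij
    · have h1 : (fun u : ℝ => ENNReal.ofReal (x * Real.exp (x * u) * E.growthTail θ 0 i j u)) =
          (Set.Iio 0).indicator fun u => ENNReal.ofReal (x * Real.exp (x * u)) := by
        ext u
        simp only [growthTail, hij, true_and, Set.indicator_apply, Set.mem_Iio]
        split_ifs <;> simp
      rw [h1, lintegral_indicator measurableSet_Iio, setLIntegral_congr Iio_ae_eq_Iic,
        lintegral_Iic_ofReal_mul_exp hx, ENNReal.ofReal_one]
    · simp [growthTail, hij]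
  | succ k ih =>
    rw [pow_succ', Matrix.mul_apply, ENNReal.ofReal_sum_of_nonneg fun m _ => mul_nonneg
      (realA_nonneg hE hG x i m) (Matrix.pow_entry_nonneg (realA_nonneg hE hG x) k m j)]
    have hmeas : ∀ m, Measurable (E.growthTail θ k m j) := fun m =>
      (growthTail_antitone hE k m j).measurable
    -- Condition on the first step: shifting `u` by `log G` costs a factor `G ^ x`, which is the one
    -- in `realA`. The shift then disappears by translation invariance.
    have h1 : ∀ u : ℝ,
        ENNReal.ofReal (x * Real.exp (x * u) * E.growthTail θ (k + 1) i j u) =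
        ∑ m, ENNReal.ofReal (E.realA θ x i m) * ENNReal.ofReal
          (x * Real.exp (x * (u - Real.log (E.G θ i m))) *
            E.growthTail θ k m j (u - Real.log (E.G θ i m))) := fun u => by
      rw [growthTail, Finset.mul_sum, ENNReal.ofReal_sum_of_nonneg fun m _ => mul_nonneg
        (by positivity) (mul_nonneg (hE.surv_mul_trans_nonneg i m) (growthTail_nonneg hE _ _ _ _))]
      refine Finset.sum_congr rfl fun m _ => ?_
      rw [← ENNReal.ofReal_mul (realA_nonneg hE hG x i m)]
      congr 1
      rw [realA, Matrix.of_apply, Real.rpow_def_of_pos (hG i m), mul_sub, Real.exp_sub,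
        mul_comm (Real.log _) x]
      field_simp
    simp only [h1]
    rw [lintegral_finsetSum _ fun m _ => by
      have := hmeas m
      fun_prop]
    refine Finset.sum_congr rfl fun m _ => ?_
    rw [lintegral_const_mul _ (by have := hmeas m; fun_prop),
      lintegral_sub_right_eq_self
        (fun u => ENNReal.ofReal (x * Real.exp (x * u) * E.growthTail θ k m j u)),
      ← ih, ENNReal.ofReal_mul (realA_nonneg hE hG x i m)]

/-- Split the exponential moment at `u = 0`: the trivial bound on the tail contributes `1`, the
assumed one `x / (y - x)`. The bound does not depend on `k`. -/
theorem realA_pow_le_of_growthTail_le (hE : E.Admissible) (hG : ∀ i j, 0 < E.G θ i j) {x y : ℝ}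
    (hx : 0 < x) (hxy : x < y) {k : ℕ} {i j : Fin N}
    (h : ∀ u, 0 < u → E.growthTail θ k i j u ≤ Real.exp (-y * u)) :
    (E.realA θ x ^ k) i j ≤ 1 + x / (y - x) := by
  have hyx : 0 < y - x := sub_pos.mpr hxy
  rw [← ENNReal.ofReal_le_ofReal_iff (by positivity), ofReal_realA_pow hE hG hx,
    ← lintegral_add_compl _ (measurableSet_Iic (a := (0 : ℝ))), Set.compl_Iic,
    ENNReal.ofReal_add zero_le_one (by positivity), ENNReal.ofReal_one,
    ← lintegral_Iic_ofReal_mul_exp hx, ← lintegral_Ioi_ofReal_mul_exp hx hyx]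
  refine add_le_add (lintegral_mono fun u => ENNReal.ofReal_le_ofReal ?_)
    (setLIntegral_mono (by fun_prop) fun u hu => ENNReal.ofReal_le_ofReal ?_)
  · exact mul_le_of_le_one_right (by positivity) (growthTail_le_one hE k i j u)
  · refine (mul_le_mul_of_nonneg_left (h u hu) (by positivity)).trans_eq ?_
    rw [mul_assoc, ← Real.exp_add]
    congr 2; ring

/-- If `ρ(A(ζ)) = 1`, then for every `y > ζ` the growth of wealth along some cycle through `i` has
a tail exceeding the exponential tail of rate `y`. -/
theorem exists_growthTail_gt (hE : E.Admissible) (hG : ∀ i j, 0 < E.G θ i j) {ζ y : ℝ}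
    (hζ0 : 0 < ζ) (hζ : spectralRadius ℂ (E.A θ (ζ : ℂ)) = 1) (hy : ζ < y) (i : Fin N) :
    ∃ k u, 0 < u ∧ Real.exp (-y * u) < E.growthTail θ k i i u := by
  by_contra! hcon
  -- `x < y` makes the moment finite, and `x > ζ` leaves room to interpolate down to a strict
  -- inequality at `ζ`.
  obtain ⟨x, hx1, hx2⟩ := exists_between hy
  have hx0 := hζ0.trans hx1
  obtain ⟨D, hD, hb⟩ := (realA_isIrreducible hE hG x).exists_pow_entry_le i
    fun k => realA_pow_le_of_growthTail_le hE hG hx0 hx2 fun u hu => hcon k u hu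
  have : spectralRadius ℂ (E.A θ (ζ : ℂ)) < 1 := mem_IMinus_of_bounded hE hG hD hζ0 hx1 hb
  exact this.ne hζ

/-- Lower bound on the tails of wealth growth along cycles. -/
theorem exists_le_growthTail (hE : E.Admissible) (hG : ∀ i j, 0 < E.G θ i j) {ζ y : ℝ}
    (hζ0 : 0 < ζ) (hζ : spectralRadius ℂ (E.A θ (ζ : ℂ)) = 1) (hy : ζ < y) (i : Fin N) :
    ∃ c : ℝ, 0 < c ∧ ∀ u, 0 ≤ u → ∃ k, c * Real.exp (-y * u) ≤ E.growthTail θ k i i u := by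
  obtain ⟨k, v, hv, h⟩ := exists_growthTail_gt hE hG hζ0 hζ hy i
  -- The constant pays for rounding `u` up to a multiple of `v`: `n + 1` repetitions reach level `u`
  -- and overshoot it by at most `v`.
  refine ⟨Real.exp (-y * v), Real.exp_pos _, fun u hu => ?_⟩
  set n := ⌊u / v⌋₊
  refine ⟨k * (n + 1), ?_⟩
  have h1 : u ≤ (n + 1) * v := ((div_lt_iff₀ hv).mp (Nat.lt_floor_add_one (u / v))).le
  have h2 : n * v ≤ u := (le_div_iff₀ hv).mp (Nat.floor_le (div_nonneg hu hv.le))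
  refine le_trans ?_ (growthTail_antitone hE _ i i h1)
  refine le_trans ?_ (growthTail_pow_le hE k i v n)
  refine le_trans ?_ (pow_le_pow_left₀ (Real.exp_pos _).le h.le (n + 1))
  rw [← Real.exp_add, ← Real.exp_nat_mul]
  refine Real.exp_le_exp.mpr ?_
  push_cast
  nlinarith [hζ0.trans hy]

end

end Economy

/-! ### The stationary law as a sum over ages, and its tail. -/

namespace Economy

variable {N : ℕ}

/-- The law of next period's wealth and ability on the event of survival, as a measure of mass
`υ`. -/
noncomputable def survLaw (E : Economy N) (θ : Fin N → ℝ) (x : ℝ × Fin N) :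
    Measure (ℝ × Fin N) :=
  ∑ n', ENNReal.ofReal (E.surv * E.trans x.2 n') • Measure.dirac (E.G θ x.2 n' * x.1, n')

/-- The law of wealth and ability of newborn agents, as a measure of mass `1 - υ`. -/
noncomputable def resetLaw (E : Economy N) : Measure (ℝ × Fin N) :=
  ∑ n', ENNReal.ofReal ((1 - E.surv) * E.birth n') • Measure.dirac (E.h, n')

/-- The transfer operator of `survLaw`. -/
noncomputable def survOp (E : Economy N) (θ : Fin N → ℝ) (f : ℝ × Fin N → ENNReal)
    (x : ℝ × Fin N) : ENNReal :=
  ∑ n', ENNReal.ofReal (E.surv * E.trans x.2 n') * f (E.G θ x.2 n' * x.1, n')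

theorem measurable_growth (E : Economy N) (θ : Fin N → ℝ) (n' : Fin N) :
    Measurable fun x : ℝ × Fin N => (E.G θ x.2 n' * x.1, n') :=
  (((measurable_from_top (f := fun n => E.G θ n n')).comp measurable_snd).mul
    measurable_fst).prodMk measurable_const

theorem measurable_survOp (E : Economy N) (θ : Fin N → ℝ) {f : ℝ × Fin N → ENNReal}
    (hf : Measurable f) : Measurable (E.survOp θ f) :=
  Finset.measurable_sum _ fun n' _ =>
    ((measurable_from_top (f := fun n => ENNReal.ofReal (E.surv * E.trans n n'))).comp
      measurable_snd).mul (hf.comp (E.measurable_growth θ n'))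

theorem lintegral_survLaw (E : Economy N) (θ : Fin N → ℝ) {f : ℝ × Fin N → ENNReal}
    (hf : Measurable f) (x : ℝ × Fin N) : ∫⁻ y, f y ∂(E.survLaw θ x) = E.survOp θ f x := by
  simp only [survLaw, survOp, lintegral_finsetSum_measure, lintegral_smul_measure,
    lintegral_dirac' _ hf, smul_eq_mul]

theorem lintegral_resetLaw (E : Economy N) {f : ℝ × Fin N → ENNReal} (hf : Measurable f) :
    ∫⁻ y, f y ∂E.resetLaw =
      ∑ n, ENNReal.ofReal ((1 - E.surv) * E.birth n) * f (E.h, n) := by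
  simp only [resetLaw, lintegral_finsetSum_measure, lintegral_smul_measure,
    lintegral_dirac' _ hf, smul_eq_mul]

theorem measurable_survLaw (E : Economy N) (θ : Fin N → ℝ) : Measurable (E.survLaw θ) := by
  refine Measure.measurable_of_measurable_coe _ fun s hs => ?_
  have h : (fun x => E.survLaw θ x s) = E.survOp θ (s.indicator 1) := by
    ext x
    rw [← lintegral_survLaw E θ (measurable_one.indicator hs), lintegral_indicator_one hs]
  rw [h]
  exact E.measurable_survOp θ (measurable_one.indicator hs)

/-- The law of wealth and ability of the agents of age `k`, as a measure of mass
`(1 - υ) υ ^ k`. -/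
noncomputable def cohort (E : Economy N) (θ : Fin N → ℝ) : ℕ → Measure (ℝ × Fin N)
  | 0 => E.resetLaw
  | k + 1 => (cohort E θ k).bind (E.survLaw θ)

theorem lintegral_cohort_succ (E : Economy N) (θ : Fin N → ℝ) {f : ℝ × Fin N → ENNReal}
    (hf : Measurable f) (k : ℕ) :
    ∫⁻ x, f x ∂(E.cohort θ (k + 1)) = ∫⁻ x, E.survOp θ f x ∂(E.cohort θ k) := by
  rw [cohort, Measure.lintegral_bind (E.measurable_survLaw θ).aemeasurable hf.aemeasurable]
  simp only [lintegral_survLaw E θ hf]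

/-- By duality the `k` survival steps act on `f`, leaving only evaluations at the newborn points
`(h, n)`. -/
theorem lintegral_cohort (E : Economy N) (θ : Fin N → ℝ) {f : ℝ × Fin N → ENNReal}
    (hf : Measurable f) (k : ℕ) :
    ∫⁻ x, f x ∂(E.cohort θ k) =
      ∑ n, ENNReal.ofReal ((1 - E.surv) * E.birth n) * (E.survOp θ)^[k] f (E.h, n) := by
  induction k generalizing f with
  | zero => exact E.lintegral_resetLaw hf
  | succ k ih =>
    rw [lintegral_cohort_succ E θ hf, ih (E.measurable_survOp θ hf), Function.iterate_succ]
    rfl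

/-- The age decomposition of the stationary distribution. -/
noncomputable def stationaryLaw (E : Economy N) (θ : Fin N → ℝ) : Measure (ℝ × Fin N) :=
  Measure.sum (E.cohort θ)

section

variable {E : Economy N} {θ : Fin N → ℝ}

theorem lintegral_kernel (hE : E.Admissible) {f : ℝ × Fin N → ENNReal} (hf : Measurable f)
    (x : ℝ × Fin N) :
    ∫⁻ y, f y ∂(E.kernel θ x) = E.survOp θ f x + ∫⁻ y, f y ∂E.resetLaw := by
  have h1 : 0 ≤ 1 - E.surv := sub_nonneg.mpr hE.surv_lt_one.le
  change ∫⁻ y, f y ∂(E.stepLaw θ x) = _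
  simp only [stepLaw, lintegral_add_measure, lintegral_smul_measure, lintegral_finsetSum_measure,
    lintegral_dirac' _ hf, smul_eq_mul, E.lintegral_resetLaw hf, survOp, Finset.mul_sum,
    ENNReal.ofReal_mul hE.surv_pos.le, ENNReal.ofReal_mul h1, mul_assoc]

theorem survOp_one (hE : E.Admissible) :
    E.survOp θ 1 = fun _ => ENNReal.ofReal E.surv := by
  ext x
  simp only [survOp, Pi.one_apply, mul_one]
  rw [← ENNReal.ofReal_sum_of_nonneg fun j _ => hE.surv_mul_trans_nonneg x.2 j,
    ← Finset.mul_sum, hE.trans_sum, mul_one]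

theorem resetLaw_univ (hE : E.Admissible) :
    E.resetLaw Set.univ = ENNReal.ofReal (1 - E.surv) := by
  have h1 : 0 ≤ 1 - E.surv := sub_nonneg.mpr hE.surv_lt_one.le
  rw [← lintegral_one, E.lintegral_resetLaw measurable_const]
  simp only [mul_one]
  rw [← ENNReal.ofReal_sum_of_nonneg fun j _ => mul_nonneg h1 (hE.birth_nonneg j),
    ← Finset.mul_sum, hE.birth_sum, mul_one]

theorem cohort_univ (hE : E.Admissible) (k : ℕ) :
    E.cohort θ k Set.univ = ENNReal.ofReal (1 - E.surv) * ENNReal.ofReal E.surv ^ k := by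
  induction k with
  | zero => rw [cohort, resetLaw_univ hE, pow_zero, mul_one]
  | succ k ih =>
    have := lintegral_cohort_succ E θ measurable_one k
    rw [survOp_one hE, lintegral_const, ih, Pi.one_def, lintegral_one] at this
    rw [this, pow_succ]
    ring

theorem isProbabilityMeasure_stationaryLaw (hE : E.Admissible) :
    IsProbabilityMeasure (E.stationaryLaw θ) := by
  constructor
  rw [stationaryLaw, Measure.sum_apply _ MeasurableSet.univ]
  simp only [cohort_univ hE]
  rw [ENNReal.tsum_mul_left, ENNReal.tsum_geometric, ENNReal.ofReal_sub _ hE.surv_pos.le,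
    ENNReal.ofReal_one]
  refine ENNReal.mul_inv_cancel ?_ (by finiteness)
  rw [← ENNReal.ofReal_one, ← ENNReal.ofReal_sub _ hE.surv_pos.le]
  simpa using hE.surv_lt_one

theorem lintegral_of_isStationary (hE : E.Admissible) {μ : Measure (ℝ × Fin N)}
    (hμ : E.IsStationary θ μ) {f : ℝ × Fin N → ENNReal} (hf : Measurable f) :
    ∫⁻ x, f x ∂μ = ∫⁻ x, E.survOp θ f x ∂μ + ∫⁻ x, f x ∂E.resetLaw := by
  have := hμ.isProbabilityMeasure
  have hinv : μ.bind (E.kernel θ) = μ := hμ.invariant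
  conv_lhs => rw [← hinv]
  rw [Measure.lintegral_bind (E.kernel θ).measurable.aemeasurable hf.aemeasurable]
  simp only [lintegral_kernel hE hf]
  rw [lintegral_add_left (E.measurable_survOp θ hf)]
  simp

theorem isStationary_stationaryLaw (hE : E.Admissible) :
    E.IsStationary θ (E.stationaryLaw θ) := by
  have hprob := isProbabilityMeasure_stationaryLaw (θ := θ) hE
  refine ⟨hprob, ?_⟩
  refine Measure.ext fun s hs => ?_
  have hf : Measurable (s.indicator (1 : ℝ × Fin N → ENNReal)) := measurable_one.indicator hs
  rw [← lintegral_indicator_one hs, ← lintegral_indicator_one hs,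
    Measure.lintegral_bind (E.kernel θ).measurable.aemeasurable hf.aemeasurable]
  simp only [lintegral_kernel hE hf]
  rw [lintegral_add_left (E.measurable_survOp θ hf), lintegral_const, measure_univ, mul_one,
    stationaryLaw, lintegral_sum_measure, lintegral_sum_measure,
    -- One step of survival shifts the series by one age, and the reset supplies the missing term `k
    -- = 0`.
    tsum_eq_zero_add' (f := fun k => ∫⁻ x, s.indicator 1 x ∂(E.cohort θ k)) ENNReal.summable,
    add_comm]
  simp only [lintegral_cohort_succ E θ hf]
  rfl

theorem eq_stationaryLaw (hE : E.Admissible) {μ : Measure (ℝ × Fin N)}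
    (hμ : E.IsStationary θ μ) : μ = E.stationaryLaw θ := by
  have := hμ.isProbabilityMeasure
  have := isProbabilityMeasure_stationaryLaw (θ := θ) hE
  -- The induction runs over all `f` at once, because unfolding invariance replaces `f` by `survOp
  -- f`.
  have key : ∀ n (f : ℝ × Fin N → ENNReal), Measurable f →
      ∑ k ∈ Finset.range n, ∫⁻ x, f x ∂(E.cohort θ k) ≤ ∫⁻ x, f x ∂μ := by
    intro n
    induction n with
    | zero => intro f _; simp
    | succ n ih =>
      intro f hf
      rw [Finset.sum_range_succ', lintegral_of_isStationary hE hμ hf]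
      simp only [lintegral_cohort_succ E θ hf]
      exact add_le_add (ih _ (E.measurable_survOp θ hf)) le_rfl
  refine (Measure.eq_of_le_of_isProbabilityMeasure (Measure.le_iff.mpr fun s hs => ?_)).symm
  rw [stationaryLaw, Measure.sum_apply _ hs]
  refine ENNReal.tsum_le_of_sum_range_le fun n => ?_
  simpa only [lintegral_indicator_one hs] using key n _ (measurable_one.indicator hs)

theorem existsUnique_isStationary (hE : E.Admissible) :
    ∃! μ : Measure (ℝ × Fin N), E.IsStationary θ μ :=
  ⟨_, isStationary_stationaryLaw hE, fun _ h => eq_stationaryLaw hE h⟩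

/-- Positive growth keeps wealth positive, so a closed form of the iterates need only be checked
there, where the rules for powers and logarithms hold. It serves for positivity, moments and tails.
-/
theorem survOp_iterate_apply_eq (hG : ∀ i j, 0 < E.G θ i j) {f : ℝ × Fin N → ENNReal}
    {F : ℕ → ℝ × Fin N → ENNReal} (h0 : ∀ x : ℝ × Fin N, 0 < x.1 → f x = F 0 x)
    (hs : ∀ k, ∀ x : ℝ × Fin N, 0 < x.1 → E.survOp θ (F k) x = F (k + 1) x) (k : ℕ) :
    ∀ x : ℝ × Fin N, 0 < x.1 → (E.survOp θ)^[k] f x = F k x := by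
  induction k with
  | zero => exact h0
  | succ k ih =>
    intro x hx
    rw [Function.iterate_succ_apply', ← hs k x hx]
    exact Finset.sum_congr rfl fun j _ => by rw [ih _ (mul_pos (hG _ _) hx)]

theorem ae_pos_stationaryLaw (hE : E.Admissible) (hG : ∀ i j, 0 < E.G θ i j) :
    ∀ᵐ x ∂(E.stationaryLaw θ), 0 < x.1 := by
  have hms : MeasurableSet {x : ℝ × Fin N | ¬ 0 < x.1} :=
    (measurableSet_lt measurable_const measurable_fst).compl
  rw [ae_iff, stationaryLaw, Measure.sum_apply _ hms, ENNReal.tsum_eq_zero]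
  intro k
  have hf := (measurable_one (α := ENNReal)).indicator hms
  rw [← lintegral_indicator_one hms, lintegral_cohort E θ hf]
  refine Finset.sum_eq_zero fun n _ => ?_
  rw [survOp_iterate_apply_eq hG (F := fun _ _ => 0) (fun x hx => by simp [hx])
    (fun k x _ => by simp [survOp]) k _ hE.h_pos, mul_zero]

theorem lintegral_rpow_cohort (hE : E.Admissible) (hG : ∀ i j, 0 < E.G θ i j) (x : ℝ) (k : ℕ) :
    ∫⁻ y, ENNReal.ofReal (y.1 ^ x) ∂(E.cohort θ k) =
      ENNReal.ofReal (∑ n, (1 - E.surv) * E.birth n * (∑ j, (E.realA θ x ^ k) n j * E.h ^ x)) := by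
  have h1 : 0 ≤ 1 - E.surv := sub_nonneg.mpr hE.surv_lt_one.le
  have hnn := fun k => Matrix.pow_entry_nonneg (realA_nonneg hE hG x) k
  have hnn' : ∀ k n, ∀ s : ℝ, 0 < s → 0 ≤ ∑ j, (E.realA θ x ^ k) n j * s ^ x := fun k n s hs =>
    Finset.sum_nonneg fun j _ => mul_nonneg (hnn k n j) (Real.rpow_nonneg hs.le x)
  rw [lintegral_cohort E θ (by fun_prop), ENNReal.ofReal_sum_of_nonneg fun n _ => mul_nonneg
    (mul_nonneg h1 (hE.birth_nonneg n)) (hnn' k n _ hE.h_pos)]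
  refine Finset.sum_congr rfl fun n _ => ?_
  rw [ENNReal.ofReal_mul (mul_nonneg h1 (hE.birth_nonneg n))]
  congr 1
  refine survOp_iterate_apply_eq hG (F := fun k y =>
    ENNReal.ofReal (∑ j, (E.realA θ x ^ k) y.2 j * y.1 ^ x)) (fun y _ => by
      simp [Matrix.one_apply]) (fun k y hy => ?_) k (E.h, n) hE.h_pos
  simp only [survOp]
  rw [pow_succ']
  simp only [Matrix.mul_apply, Finset.sum_mul]
  rw [Finset.sum_comm, ENNReal.ofReal_sum_of_nonneg fun m _ => Finset.sum_nonneg fun j _ =>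
    mul_nonneg (mul_nonneg (realA_nonneg hE hG x _ _) (hnn k _ _)) (Real.rpow_nonneg hy.le x)]
  refine Finset.sum_congr rfl fun m _ => ?_
  rw [← ENNReal.ofReal_mul (hE.surv_mul_trans_nonneg _ _), Finset.mul_sum]
  congr 1
  refine Finset.sum_congr rfl fun j _ => ?_
  rw [Real.mul_rpow (hG _ _).le hy.le]
  simp only [realA, Matrix.of_apply]
  ring

theorem lintegral_rpow_stationaryLaw_lt_top (hE : E.Admissible) (hG : ∀ i j, 0 < E.G θ i j)
    {x : ℝ} (hx : x ∈ E.IMinus θ) :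
    ∫⁻ y, ENNReal.ofReal (y.1 ^ x) ∂(E.stationaryLaw θ) < ⊤ := by
  obtain ⟨C, r, hC, hr0, hr1, h⟩ := exists_realA_pow_le_of_mem_IMinus hG hx
  have h1 : 0 ≤ 1 - E.surv := sub_nonneg.mpr hE.surv_lt_one.le
  have hh := hE.h_pos
  rw [stationaryLaw, lintegral_sum_measure]
  simp only [lintegral_rpow_cohort hE hG]
  set D : ℝ := ∑ n, (1 - E.surv) * E.birth n * ∑ _j : Fin N, C * E.h ^ x
  have hb : ∀ k : ℕ,
      ∑ n, (1 - E.surv) * E.birth n * (∑ j, (E.realA θ x ^ k) n j * E.h ^ x) ≤ D * r ^ k := by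
    intro k
    rw [Finset.sum_mul]
    refine Finset.sum_le_sum fun n _ => ?_
    rw [mul_assoc ((1 - E.surv) * E.birth n), Finset.sum_mul]
    refine mul_le_mul_of_nonneg_left (Finset.sum_le_sum fun j _ => ?_)
      (mul_nonneg h1 (hE.birth_nonneg n))
    calc (E.realA θ x ^ k) n j * E.h ^ x ≤ C * r ^ k * E.h ^ x := by
          gcongr
          exact h k n j
      _ = C * E.h ^ x * r ^ k := by ring
  refine lt_of_le_of_lt (ENNReal.tsum_le_tsum fun k => ENNReal.ofReal_le_ofReal (hb k)) ?_
  exact ((summable_geometric_of_lt_one hr0.le hr1).mul_left D).tsum_ofReal_lt_top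

/-- Keep only the agents of age `k` born in state `i` and now in state `i`. Starting from `h`, their
wealth exceeds `s` exactly when log growth exceeds `log s - log h`. -/
theorem le_stationaryLaw_tail (hE : E.Admissible) (hG : ∀ i j, 0 < E.G θ i j) (k : ℕ)
    (i : Fin N) {s : ℝ} (hs : 0 < s) :
    (1 - E.surv) * E.birth i * E.growthTail θ k i i (Real.log s - Real.log E.h) ≤
      (E.stationaryLaw θ).real {x | s < x.1} := by
  have := isProbabilityMeasure_stationaryLaw (θ := θ) hE
  have h1 : 0 ≤ 1 - E.surv := sub_nonneg.mpr hE.surv_lt_one.le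
  have hms : MeasurableSet {x : ℝ × Fin N | s < x.1 ∧ x.2 = i} :=
    (measurableSet_lt measurable_const measurable_fst).inter
      (measurable_snd (measurableSet_singleton i))
  have hf := (measurable_one (α := ENNReal)).indicator hms
  refine (ENNReal.ofReal_le_iff_le_toReal (measure_ne_top _ _)).mp ?_
  calc ENNReal.ofReal ((1 - E.surv) * E.birth i *
        E.growthTail θ k i i (Real.log s - Real.log E.h))
      = ENNReal.ofReal ((1 - E.surv) * E.birth i) * ENNReal.ofReal
          (E.growthTail θ k i i (Real.log s - Real.log E.h)) :=
        ENNReal.ofReal_mul (mul_nonneg h1 (hE.birth_nonneg i))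
    _ ≤ ∑ n, ENNReal.ofReal ((1 - E.surv) * E.birth n) * ENNReal.ofReal
          (E.growthTail θ k n i (Real.log s - Real.log E.h)) :=
        Finset.single_le_sum (f := fun n => ENNReal.ofReal ((1 - E.surv) * E.birth n) *
          ENNReal.ofReal (E.growthTail θ k n i (Real.log s - Real.log E.h)))
          (fun _ _ => zero_le) (Finset.mem_univ i)
    _ = E.cohort θ k {x | s < x.1 ∧ x.2 = i} := by
        rw [← lintegral_indicator_one hms, lintegral_cohort E θ hf]
        refine Finset.sum_congr rfl fun n _ => ?_
        congr 1
        refine (survOp_iterate_apply_eq hG (F := fun k y => ENNReal.ofReal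
          (E.growthTail θ k y.2 i (Real.log s - Real.log y.1))) (fun y hy => ?_)
          (fun k y hy => ?_) k (E.h, n) hE.h_pos).symm
        · rw [growthTail, Set.indicator_apply]
          simp only [Set.mem_ofPred_eq, sub_neg, Real.log_lt_log_iff hs hy, and_comm]
          split_ifs <;> simp
        · simp only [survOp, growthTail]
          rw [ENNReal.ofReal_sum_of_nonneg fun m _ => mul_nonneg (hE.surv_mul_trans_nonneg _ _)
            (growthTail_nonneg hE _ _ _ _)]
          refine Finset.sum_congr rfl fun m _ => ?_
          rw [ENNReal.ofReal_mul (hE.surv_mul_trans_nonneg _ _),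
            Real.log_mul (hG _ _).ne' hy.ne', sub_sub, add_comm (Real.log y.1)]
    _ ≤ E.stationaryLaw θ {x | s < x.1 ∧ x.2 = i} := Measure.le_sum (E.cohort θ) k _
    _ ≤ E.stationaryLaw θ {x | s < x.1} := measure_mono fun x hx => hx.1

theorem stationaryLaw_tail_le (hE : E.Admissible) (hG : ∀ i j, 0 < E.G θ i j) {x : ℝ}
    (hx0 : 0 < x) (hx : x ∈ E.IMinus θ) :
    ∃ C : ℝ, 0 < C ∧ ∀ s, 0 < s →
      (E.stationaryLaw θ).real {y | s < y.1} ≤ C * s ^ (-x) := by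
  have hM := lintegral_rpow_stationaryLaw_lt_top hE hG hx
  set M := ∫⁻ y, ENNReal.ofReal (y.1 ^ x) ∂(E.stationaryLaw θ)
  -- Markov's inequality for `S ^ x`; the added `1` only makes the constant positive.
  refine ⟨M.toReal + 1, by positivity, fun s hs => ?_⟩
  have hsx := Real.rpow_pos_of_pos hs x
  have h1 : ENNReal.ofReal (s ^ x) * E.stationaryLaw θ {y | s < y.1} ≤ M :=
    le_trans (mul_le_mul_right (measure_mono fun y hy => ENNReal.ofReal_le_ofReal
      (Real.rpow_le_rpow hs.le (le_of_lt hy) hx0.le)) _)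
      (mul_meas_ge_le_lintegral (by fun_prop) _)
  have h2 := ENNReal.toReal_mono hM.ne h1
  rw [ENNReal.toReal_mul, ENNReal.toReal_ofReal hsx.le] at h2
  rw [Real.rpow_neg hs.le, ← div_eq_mul_inv, le_div_iff₀ hsx, mul_comm]
  exact h2.trans (by linarith)

theorem tendsto_log_tail (hE : E.Admissible) (hG : ∀ i j, 0 < E.G θ i j) {ζ : ℝ} (hζ0 : 0 < ζ)
    (hζ : spectralRadius ℂ (E.A θ (ζ : ℂ)) = 1) :
    Tendsto (fun s : ℝ => Real.log ((E.stationaryLaw θ).real {x | s < x.1}) / Real.log s) atTop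
      (𝓝 (-ζ)) := by
  refine tendsto_log_div_log_of_bounds hζ0 (fun x hx0 hxζ => ?_) (fun y hy => ?_)
  · obtain ⟨C, hC, h⟩ := stationaryLaw_tail_le hE hG hx0
      (mem_IMinus_of_spectralRadius_eq_one hE hG hζ hx0 hxζ)
    exact ⟨C, hC, (eventually_gt_atTop 0).mono h⟩
  · have h1 : 0 < 1 - E.surv := sub_pos.mpr hE.surv_lt_one
    have hh := hE.h_pos
    obtain ⟨i, -, hi⟩ : ∃ i ∈ Finset.univ, 0 < E.birth i :=
      Finset.exists_lt_of_sum_lt (f := fun _ => (0 : ℝ)) (by simp [hE.birth_sum])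
    obtain ⟨c, hc, h⟩ := exists_le_growthTail hE hG hζ0 hζ hy i
    -- `exp (-y (log s - log h)) = h^y s^(-y)`, and `s ≥ h` makes the required log growth
    -- nonnegative.
    refine ⟨(1 - E.surv) * E.birth i * (c * E.h ^ y), by positivity, ?_⟩
    filter_upwards [eventually_ge_atTop E.h] with s hs
    have hs0 := hh.trans_le hs
    obtain ⟨k, hk⟩ := h (Real.log s - Real.log E.h) (sub_nonneg.mpr (Real.log_le_log hh hs))
    refine le_trans ?_ (le_stationaryLaw_tail hE hG k i hs0)
    rw [mul_assoc]
    refine mul_le_mul_of_nonneg_left (le_trans (le_of_eq ?_) hk) (by positivity)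
    rw [mul_assoc, Real.rpow_def_of_pos hh, Real.rpow_def_of_pos hs0, ← Real.exp_add]
    congr 2; ring

end

end Economy

/-! ### Complex moments and the main theorem. -/

namespace Economy

variable {N : ℕ} {E : Economy N} {θ : Fin N → ℝ}

theorem isMarkovKernel_kernel (hE : E.Admissible) : IsMarkovKernel (E.kernel θ) := by
  refine ⟨fun x => ⟨?_⟩⟩
  have h := lintegral_kernel (θ := θ) hE measurable_one x
  rw [survOp_one hE, Pi.one_def, lintegral_one, lintegral_one, resetLaw_univ hE,
    ← ENNReal.ofReal_add hE.surv_pos.le (sub_nonneg.mpr hE.surv_lt_one.le), add_sub_cancel,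
    ENNReal.ofReal_one] at h
  exact h

/-- The kernel is a finite combination of point masses, so every `f` is integrable against it. -/
theorem integral_kernel (hE : E.Admissible) {f : ℝ × Fin N → ℂ} (x : ℝ × Fin N) :
    ∫ y, f y ∂(E.kernel θ x) =
      (E.surv : ℂ) * ∑ j, (E.trans x.2 j : ℂ) * f (E.G θ x.2 j * x.1, j) +
        (1 - (E.surv : ℂ)) * ∑ j, (E.birth j : ℂ) * f (E.h, j) := by
  have h1 : 0 ≤ 1 - E.surv := sub_nonneg.mpr hE.surv_lt_one.le
  have hint : ∀ (c : Fin N → ℝ) (p : Fin N → ℝ × Fin N), ∀ j ∈ Finset.univ,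
      Integrable f (ENNReal.ofReal (c j) • Measure.dirac (p j)) := fun c p j _ =>
    (integrable_dirac (by finiteness)).smul_measure ENNReal.ofReal_ne_top
  change ∫ y, f y ∂(E.stepLaw θ x) = _
  rw [stepLaw, integral_add_measure
      ((integrable_finsetSum_measure.mpr (hint _ _)).smul_measure ENNReal.ofReal_ne_top)
      ((integrable_finsetSum_measure.mpr (hint _ _)).smul_measure ENNReal.ofReal_ne_top),
    integral_smul_measure, integral_smul_measure, integral_finsetSum_measure (hint _ _),
    integral_finsetSum_measure (hint _ _)]
  simp only [integral_smul_measure, integral_dirac, ENNReal.toReal_ofReal hE.surv_pos.le,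
    ENNReal.toReal_ofReal h1, ENNReal.toReal_ofReal (hE.trans_irreducible.nonneg _ _),
    ENNReal.toReal_ofReal (hE.birth_nonneg _), Complex.real_smul, Complex.ofReal_sub,
    Complex.ofReal_one]

theorem measurableSet_ability (n : Fin N) : MeasurableSet {x : ℝ × Fin N | x.2 = n} :=
  measurable_snd (measurableSet_singleton n)

section

variable {z : ℂ}

theorem integrable_cpow_stationaryLaw (hE : E.Admissible) (hG : ∀ i j, 0 < E.G θ i j)
    (hz : z.re ∈ E.IMinus θ) :
    Integrable (fun x : ℝ × Fin N => (x.1 : ℂ) ^ z) (E.stationaryLaw θ) := by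
  refine ⟨(by fun_prop : Measurable fun x : ℝ × Fin N => (x.1 : ℂ) ^ z).aestronglyMeasurable, ?_⟩
  refine lt_of_le_of_lt (lintegral_mono_ae ?_)
    (lintegral_rpow_stationaryLaw_lt_top hE hG hz)
  filter_upwards [ae_pos_stationaryLaw hE hG] with x hx
  rw [← ofReal_norm, Complex.norm_cpow_eq_rpow_re_of_pos hx]

/-- The complex moment `E (S ^ z; J = n)` of the stationary distribution. -/
noncomputable def abilityMoment (E : Economy N) (θ : Fin N → ℝ) (z : ℂ) (n : Fin N) : ℂ :=
  ∫ x in {x | x.2 = n}, (x.1 : ℂ) ^ z ∂(E.stationaryLaw θ)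

theorem integral_cpow_eq_sum_abilityMoment (hE : E.Admissible) (hG : ∀ i j, 0 < E.G θ i j)
    (hz : z.re ∈ E.IMinus θ) (c : Fin N → ℂ) :
    ∫ x, c x.2 * (x.1 : ℂ) ^ z ∂(E.stationaryLaw θ) = ∑ i, c i * E.abilityMoment θ z i := by
  have hint := integrable_cpow_stationaryLaw hE hG hz
  have h1 : ∀ x : ℝ × Fin N, c x.2 * (x.1 : ℂ) ^ z =
      ∑ i, c i * ({x : ℝ × Fin N | x.2 = i}.indicator (fun x => (x.1 : ℂ) ^ z) x) := fun x => by
    simp [Set.indicator_apply]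
  simp only [h1]
  rw [integral_finsetSum _ fun i _ => (hint.indicator (measurableSet_ability i)).const_mul _]
  simp only [integral_const_mul, integral_indicator (measurableSet_ability _), abilityMoment]

/-- Invariance tested on `s^z 1{J=n}`: survival from state `i` contributes `A(z)_{in} s^z`, and the
reset contributes a constant. -/
theorem abilityMoment_eq (hE : E.Admissible) (hG : ∀ i j, 0 < E.G θ i j)
    (hz : z.re ∈ E.IMinus θ) (n : Fin N) :
    E.abilityMoment θ z n = ∑ i, E.A θ z i n * E.abilityMoment θ z i +
      (1 - (E.surv : ℂ)) * (E.birth n : ℂ) * (E.h : ℂ) ^ z := by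
  have := isProbabilityMeasure_stationaryLaw (θ := θ) hE
  have := isMarkovKernel_kernel (θ := θ) hE
  have hint := integrable_cpow_stationaryLaw hE hG hz
  have hinv : (E.stationaryLaw θ).bind (E.kernel θ) = E.stationaryLaw θ :=
    (isStationary_stationaryLaw hE).invariant
  set f : ℝ × Fin N → ℂ := {x : ℝ × Fin N | x.2 = n}.indicator fun x => (x.1 : ℂ) ^ z with hf
  have hfint : Integrable f (E.stationaryLaw θ) := hint.indicator (measurableSet_ability n)
  have hstep : ∀ᵐ x ∂(E.stationaryLaw θ), ∫ y, f y ∂(E.kernel θ x) =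
      E.A θ z x.2 n * (x.1 : ℂ) ^ z + (1 - (E.surv : ℂ)) * (E.birth n : ℂ) * (E.h : ℂ) ^ z := by
    filter_upwards [ae_pos_stationaryLaw hE hG] with x hx
    rw [integral_kernel hE]
    simp only [hf, Set.indicator_apply, Set.mem_ofPred_eq, mul_ite, mul_zero, Finset.sum_ite_eq',
      Finset.mem_univ, if_true, A, Matrix.of_apply, Complex.ofReal_mul]
    rw [Complex.mul_cpow_ofReal_nonneg (hG _ _).le hx.le]
    ring
  have hA : Integrable (fun x : ℝ × Fin N => E.A θ z x.2 n * (x.1 : ℂ) ^ z)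
      (E.stationaryLaw θ) := by
    refine hint.bdd_mul (c := ∑ i, ‖E.A θ z i n‖)
      ((measurable_from_top (f := fun i => E.A θ z i n)).comp measurable_snd).aestronglyMeasurable
      (ae_of_all _ fun x => ?_)
    exact Finset.single_le_sum (f := fun i => ‖E.A θ z i n‖) (fun _ _ => norm_nonneg _)
      (Finset.mem_univ x.2)
  calc E.abilityMoment θ z n = ∫ x, f x ∂(E.stationaryLaw θ) := by
        rw [hf, integral_indicator (measurableSet_ability n), abilityMoment]
    _ = ∫ x, ∫ y, f y ∂(E.kernel θ x) ∂(E.stationaryLaw θ) := by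
        conv_lhs => rw [← hinv]
        -- The law is viewed as a constant kernel, so that iterated integration becomes kernel
        -- composition.
        refine Kernel.integral_comp (κ := Kernel.const Unit (E.stationaryLaw θ)) (a := ())
          (η := E.kernel θ) ?_
        rwa [Kernel.comp_apply, Kernel.const_apply, hinv]
    _ = _ := by
        rw [integral_congr_ae hstep, integral_add hA (integrable_const _),
          integral_cpow_eq_sum_abilityMoment hE hG hz fun i => E.A θ z i n]
        simp

/-- Solves `mᵀ(I - A(z)) = (1-υ) h^z ϖᵀ` by multiplying by the inverse on the right. A unit vector
`v` yields the conditional moments, the vector of ones the full moment. -/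
theorem sum_abilityMoment_mul (hE : E.Admissible) (hG : ∀ i j, 0 < E.G θ i j)
    (hz : z.re ∈ E.IMinus θ) (v : Fin N → ℂ) :
    E.abilityMoment θ z ⬝ᵥ v = (1 - (E.surv : ℂ)) * (E.h : ℂ) ^ z *
      ((fun m => (E.birth m : ℂ)) ⬝ᵥ ((1 - E.A θ z)⁻¹ *ᵥ v)) := by
  have hunit := (Matrix.isUnit_iff_isUnit_det _).mp (isUnit_one_sub_A hE hG hz)
  have h1 : E.abilityMoment θ z ᵥ* (1 - E.A θ z) =
      ((1 - (E.surv : ℂ)) * (E.h : ℂ) ^ z) • fun m => (E.birth m : ℂ) := by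
    rw [Matrix.vecMul_sub, Matrix.vecMul_one]
    ext n
    have h2 : (E.abilityMoment θ z ᵥ* E.A θ z) n =
        ∑ i, E.A θ z i n * E.abilityMoment θ z i := by
      rw [Matrix.vecMul, dotProduct]
      exact Finset.sum_congr rfl fun i _ => mul_comm _ _
    rw [Pi.sub_apply, h2, sub_eq_iff_eq_add, abilityMoment_eq hE hG hz n, Pi.smul_apply,
      smul_eq_mul]
    ring
  rw [← smul_eq_mul ((1 - (E.surv : ℂ)) * (E.h : ℂ) ^ z), ← smul_dotProduct, ← h1,
    Matrix.dotProduct_mulVec, Matrix.vecMul_vecMul, Matrix.mul_nonsing_inv _ hunit,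
    Matrix.vecMul_one]

end

end Economy

theorem proposition2 {N : ℕ} (E : Economy N) (hE : E.Admissible)
    (a θ : Fin N → ℝ) (hθ : E.IsOptimal a θ) :
    (∃! μ : Measure (ℝ × Fin N), E.IsStationary θ μ) ∧
    ∀ μ : Measure (ℝ × Fin N), E.IsStationary θ μ →
      (∀ z : ℂ, z.re ∈ E.IMinus θ →
        IsUnit (1 - E.A θ z) ∧
        (∀ n : Fin N, 0 < μ.real {x | x.2 = n} →
          Integrable (fun x => (x.1 : ℂ) ^ z) (μ[|{x | x.2 = n}]) ∧
          ∫ x, (x.1 : ℂ) ^ z ∂(μ[|{x | x.2 = n}]) =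
            (1 - (E.surv : ℂ)) * ((μ.real {x | x.2 = n} : ℝ) : ℂ)⁻¹ * (E.h : ℂ) ^ z *
              ((fun m => (E.birth m : ℂ)) ⬝ᵥ ((1 - E.A θ z)⁻¹ *ᵥ Pi.single n 1))) ∧
        Integrable (fun x => (x.1 : ℂ) ^ z) μ ∧
        ∫ x, (x.1 : ℂ) ^ z ∂μ =
          (1 - (E.surv : ℂ)) * (E.h : ℂ) ^ z *
            ((fun m => (E.birth m : ℂ)) ⬝ᵥ ((1 - E.A θ z)⁻¹ *ᵥ (fun _ => 1)))) ∧
      (∀ ζ : ℝ, 0 < ζ → spectralRadius ℂ (E.A θ (ζ : ℂ)) = 1 →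
        (∀ x : ℝ, 0 < x → spectralRadius ℂ (E.A θ (x : ℂ)) = 1 → x = ζ) →
        Tendsto (fun s : ℝ => Real.log (μ.real {x | s < x.1}) / Real.log s) atTop
          (𝓝 (-ζ))) := by
  have hG := hE.G_pos hθ.θ_mem
  refine ⟨Economy.existsUnique_isStationary hE, fun μ hμ => ?_⟩
  obtain rfl := Economy.eq_stationaryLaw hE hμ
  refine ⟨fun z hz => ?_, fun ζ hζ0 hζ _ => Economy.tendsto_log_tail hE hG hζ0 hζ⟩
  have hint := Economy.integrable_cpow_stationaryLaw hE hG hz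
  refine ⟨Economy.isUnit_one_sub_A hE hG hz, fun n hn => ⟨?_, ?_⟩, hint, ?_⟩
  -- Conditioning is restriction scaled by the inverse mass, which is finite because the mass is
  -- positive.
  · refine hint.restrict.smul_measure (ENNReal.inv_ne_top.mpr fun h0 => hn.ne' ?_)
    rw [measureReal_def, h0, ENNReal.toReal_zero]
  · have h := Economy.sum_abilityMoment_mul hE hG hz (Pi.single n 1)
    rw [dotProduct_single_one, Economy.abilityMoment] at h
    rw [ProbabilityTheory.cond, integral_smul_measure, h, ENNReal.toReal_inv,
      Complex.real_smul, Complex.ofReal_inv, measureReal_def]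
    ring
  · rw [← Economy.sum_abilityMoment_mul hE hG hz]
    have h := Economy.integral_cpow_eq_sum_abilityMoment hE hG hz fun _ => 1
    simpa [dotProduct] using h
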